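/- Let $L,M,q,s,B>0$, $\Omega=\{(b,d)\in\mathbb R^2: 0<b<d\le L\}$ and $\partial\Omega=\{(t,t):0\le t\le L\}$. A persistence measure is a counting measure $\mu=\sum_{1\le i\le N}\delta_{x_i}$ of a locally finite multiset of points $x_i\in\Omega$, and $\mathcal Z=\mathcal Z^q_{L,M}$ is the set of persistence measures with $\int_\Omega\|x-\partial\Omega\|_2^q\,d\mu(x)<M$ (with the $\sigma$-algebra generated by the maps $\mu\mapsto\mu(A)$, $A$ Borel). For a probability distribution $P$ on $\mathcal Z$ with $0<N<\infty$ almost surely, the persistence density $\tilde p$ of $P$ is the Lebesgue density on $\Omega$, when it exists, of $A\mapsto\mathbb E_{\mu\sim P}[\mu(A)/N]$. For an integer $r>s$ let $$\|f\|_{B^s_{\infty,\infty}}=\sup_{x\in\Omega}|f(x)|+\sup_{h\ne0}\ \|h\|^{-s}\sup_{x,\,x+rh\in\Omega}|\Delta_h^r f(x)|,$$ where $\Delta_h f(x)=f(x+h)-f(x)$, and let $\mathscr F=\{f:\Omega\to\mathbb R\text{ continuous},\ \|f\|_{B^s_{\infty,\infty}}\le B\}$. Let $B_*$ be the infimum of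 $\|\tilde p\|_{B^s_{\infty,\infty}}$ over all $P$ on $\mathcal Z$ that have a continuous persistence density $\tilde p$. Then $B_*<\infty$, and there is a constant $c>0$, depending only on $L,M,q,s,B,r$, such that for every $n\ge1$ $$\inf_{\check p_n}\ \sup_{P}\ \mathbb E_{\mu_1,\dots,\mu_n\overset{\text{i.i.d.}}{\sim}P}\,\|\check p_n-\tilde p\|_{\infty}\ \ge\ c\,n^{-\frac{s}{2(s+1)}},$$ where the infimum is over all measurable estimators $\check p_n$ mapping $(\mu_1,\dots,\mu_n)\in\mathcal Z^n$ to an element of $\mathscr F$, the supremum is over all probability distributions $P$ on $\mathcal Z$ that have a persistence density $\tilde p$, and $\|\cdot\|_\infty$ is the $L_\infty(\Omega)$ norm. If moreover $B>B_*$, the same bound holds, with the same $c$, when the supremum is restricted to those $P$ for which $\tilde p\in\mathscr F$. -/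

import Mathlib

open MeasureTheory Set
open scoped ENNReal fwdDiff

noncomputable section

namespace Persistence

/-- The plane with its Euclidean norm; a point is `(birth, death) = (x 0, x 1)`. -/
abbrev Plane : Type := EuclideanSpace ℝ (Fin 2)

/-- The triangle `Ω = {(b, d) : 0 < b < d ≤ L}`. -/
def Omega (L : ℝ) : Set Plane := {x | 0 < x 0 ∧ x 0 < x 1 ∧ x 1 ≤ L}

/-- The diagonal segment `∂Ω = {(t, t) : 0 ≤ t ≤ L}`. -/
def diagonal (L : ℝ) : Set Plane := {x | x 0 = x 1 ∧ 0 ≤ x 0 ∧ x 0 ≤ L}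

/-- A persistence measure on `Ω`: the counting measure `∑ i, δ_{r i}` of a locally finite
multiset of points `r i` of `Ω`, with `N` points, where `N` may be `0` or infinite. -/
def IsPersistenceMeasure (L : ℝ) (μ : Measure Plane) : Prop :=
  ∃ (N : ℕ∞) (r : ℕ → Plane),
    (∀ i : ℕ, (i : ℕ∞) < N → r i ∈ Omega L) ∧
    μ = Measure.sum (fun i : {i : ℕ // (i : ℕ∞) < N} => Measure.dirac (r i)) ∧
    ∀ K ⊆ Omega L, IsCompact K → μ K < ∞

/-- Total `q`-persistence `∫ ‖x - ∂Ω‖₂ ^ q dμ(x)`. -/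
def totalPersistence (L q : ℝ) (μ : Measure Plane) : ℝ≥0∞ :=
  ∫⁻ x, ENNReal.ofReal (Metric.infDist x (diagonal L) ^ q) ∂μ

/-- Persistence measures on `Ω` with total `q`-persistence smaller than `M`. It carries the
`σ`-algebra generated by the evaluations `μ ↦ μ A`, for Borel sets `A`. -/
abbrev PersSpace (L M q : ℝ) : Type :=
  {μ : Measure Plane // IsPersistenceMeasure L μ ∧ totalPersistence L q μ < ENNReal.ofReal M}

/-- The normalized persistence measure `μ / N`, where `N = μ(Ω)` is the number of points. -/
def normalized (μ : Measure Plane) : Measure Plane := (μ univ)⁻¹ • μ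

/-- `p` is (a version of) the persistence density of `P`, that is, the Lebesgue density on `Ω`
of the expected normalized measure `A ↦ E_P[μ(A) / N]`. Almost all diagrams have to be finite
and nonempty, as their normalized measures are not defined otherwise. -/
structure IsPersistenceDensity {L M q : ℝ} (P : ProbabilityMeasure (PersSpace L M q))
    (p : Plane → ℝ) : Prop where
  finite_nonempty : ∀ᵐ μ ∂(P : Measure (PersSpace L M q)), 0 < μ.1 univ ∧ μ.1 univ < ∞
  aemeasurable : AEMeasurable p (volume.restrict (Omega L))
  nonneg : ∀ x ∈ Omega L, 0 ≤ p x
  density : ∀ A ⊆ Omega L, MeasurableSet A →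
    ∫⁻ μ, normalized μ.1 A ∂(P : Measure (PersSpace L M q)) = ∫⁻ x in A, ENNReal.ofReal (p x)

/-- The norm of the Besov space `B^s_{∞,∞}(Ω)` through differences of order `r > s`:
`sup_{x ∈ Ω} |f x| + sup_{h ≠ 0} ‖h‖ ^ (-s) sup_x |Δ_h^r f(x)|`, where `x` ranges over the points
for which `x` and `x + r h` (hence the whole segment, `Ω` being convex) lie in `Ω`. -/
def besovNorm (L s : ℝ) (r : ℕ) (f : Plane → ℝ) : ℝ≥0∞ :=
  (⨆ x ∈ Omega L, ‖f x‖ₑ) +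
    ⨆ (h : Plane) (_ : h ≠ 0) (x : Plane) (_ : x ∈ Omega L ∧ x + r • h ∈ Omega L),
      ‖(fwdDiff h)^[r] f x‖ₑ / ENNReal.ofReal (‖h‖ ^ s)

/-- The ball of radius `B` of `B^s_{∞,∞}(Ω)`, a space of continuous functions. Only the values
on `Ω` matter. -/
def besovBall (L s : ℝ) (r : ℕ) (B : ℝ) : Set (Plane → ℝ) :=
  {f | ContinuousOn f (Omega L) ∧ besovNorm L s r f ≤ ENNReal.ofReal B}

/-- An estimator: a measurable map from samples of `n` persistence measures to the Besov ball. -/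
structure IsEstimator {L M q : ℝ} (s : ℝ) (r : ℕ) (B : ℝ) (n : ℕ)
    (T : (Fin n → PersSpace L M q) → Plane → ℝ) : Prop where
  mem_ball : ∀ D, T D ∈ besovBall L s r B
  measurable : ∀ x ∈ Omega L, Measurable fun D => T D x

/-- Expected `L_∞(Ω)` error of `T` at the target `p`, for `n` independent draws from `P`. The norm
is the essential supremum, so it does not depend on the version of the density `p`; it is the
supremum over `Ω` when `p` is continuous. -/
def risk {L M q : ℝ} {n : ℕ} (T : (Fin n → PersSpace L M q) → Plane → ℝ)
    (P : ProbabilityMeasure (PersSpace L M q)) (p : Plane → ℝ) : ℝ≥0∞ :=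
  ∫⁻ D, eLpNorm (fun x => T D x - p x) ∞ (volume.restrict (Omega L))
    ∂(Measure.pi fun _ : Fin n => (P : Measure (PersSpace L M q)))

/-- Minimax risk, with the supremum over the distributions whose persistence density exists
and belongs to the class `G`. -/
def minimaxRisk (L M q s : ℝ) (r : ℕ) (B : ℝ) (n : ℕ) (G : Set (Plane → ℝ)) : ℝ≥0∞ :=
  ⨅ (T : (Fin n → PersSpace L M q) → Plane → ℝ) (_ : IsEstimator s r B n T),
    ⨆ (P : ProbabilityMeasure (PersSpace L M q)) (p : Plane → ℝ)
      (_ : IsPersistenceDensity P p ∧ p ∈ G), risk T P p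

/-- The infimum of the Besov norms of all continuous persistence densities. Below this value
the Besov ball contains no persistence density. -/
def leastDensityNorm (L M q s : ℝ) (r : ℕ) : ℝ≥0∞ :=
  ⨅ (P : ProbabilityMeasure (PersSpace L M q)) (p : Plane → ℝ)
    (_ : IsPersistenceDensity P p ∧ ContinuousOn p (Omega L)), besovNorm L s r p

end Persistence

end

namespace Persistence

/-! ### Smooth functions and differences -/

/-! The proof is Le Cam's two-point method. A one-point diagram `δ_x` is its own normalization, so
every density on a small disc of `Ω` close enough to the diagonal is the persistence density of a
law of one-point diagrams. Take a bump density `g`, equal to a constant `a` near the centre `y`, and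
its perturbation `g (1 + u)`, where `u x = t ^ s * φ ((x - y) / t)`, `φ` has integral zero and `φ 0
= 1`. The Besov bounds of `u` do not depend on `t ≤ 1`, the two densities differ by `a t ^ s` at
`y`, and their `χ²` divergence is `a t ^ (2 s + 2) ∫ φ ^ 2`. For `t` of order `n ^ (-1 / (2 (s +
1)))` this is at most `1 / n`, so `n` observations cannot separate the two laws, and an error of
order `t ^ s` at `y` is unavoidable (`two_point_bound`).

The densities must also fit in the ball of radius `B`, which may barely exceed `B_*`. Hence both
one-point laws enter only with a small fixed weight `ε`, mixed with a law `P` whose density has norm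
below `B`. Nothing else about `P` is needed: it is common to both hypotheses
(`two_point_bound_mix`).

The radius of the ball in which estimators take their values plays no role; only their continuity
and measurability are used. So if `B ≤ B_*`, the same argument with densities in a larger ball gives
the unrestricted bound. -/

theorem norm_fwdDiff_iterate_le_of_bound {E F : Type*} [AddCommMonoid E] [NormedAddCommGroup F]
    {f : E → F} {C : ℝ} (hf : ∀ x, ‖f x‖ ≤ C) (r : ℕ) (h x : E) :
    ‖(fwdDiff h)^[r] f x‖ ≤ 2 ^ r * C := by
  induction r generalizing x with
  | zero => simpa using hf x
  | succ r ih =>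
    rw [Function.iterate_succ_apply']
    calc ‖(fwdDiff h)^[r] f (x + h) - (fwdDiff h)^[r] f x‖
        ≤ 2 ^ r * C + 2 ^ r * C := (norm_sub_le _ _).trans (add_le_add (ih _) (ih _))
      _ = 2 ^ (r + 1) * C := by ring

theorem hasFDerivAt_fwdDiff_iterate {E F : Type*} [NormedAddCommGroup E] [NormedSpace ℝ E]
    [NormedAddCommGroup F] [NormedSpace ℝ F] {f : E → F} (hf : Differentiable ℝ f)
    (r : ℕ) (h x : E) :
    HasFDerivAt ((fwdDiff h)^[r] f) ((fwdDiff h)^[r] (fderiv ℝ f) x) x := by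
  induction r generalizing x with
  | zero => exact (hf x).hasFDerivAt
  | succ r ih =>
    rw [Function.iterate_succ_apply', Function.iterate_succ_apply']
    exact ((hasFDerivAt_comp_add_right h).2 (ih (x + h))).sub (ih x)

/-- Differences of order `r` of a compactly supported smooth function are `O(‖h‖ ^ r)`. -/
theorem exists_norm_fwdDiff_iterate_le {E F : Type} [NormedAddCommGroup E] [NormedSpace ℝ E]
    [NormedAddCommGroup F] [NormedSpace ℝ F] (r : ℕ) {f : E → F}
    (hf : ContDiff ℝ (⊤ : ℕ∞) f) (hc : HasCompactSupport f) :
    ∃ C, ∀ h x, ‖(fwdDiff h)^[r] f x‖ ≤ C * ‖h‖ ^ r := by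
  induction r generalizing F with
  | zero =>
    obtain ⟨C, hC⟩ := hf.continuous.bounded_above_of_compact_support hc
    exact ⟨C, fun h x => by simpa using hC x⟩
  | succ r ih =>
    -- Differences commute with the derivative, so the inductive hypothesis for `fderiv ℝ f` bounds
    -- the derivative of the `r`-th difference; the mean value inequality from `x` to `x + h` gains
    -- one factor `‖h‖`. This is why the induction ranges over all `F`.
    obtain ⟨C, hC⟩ := ih (hf.fderiv_right (m := (⊤ : ℕ∞)) (by simp)) (hc.fderiv ℝ)
    refine ⟨C, fun h x => ?_⟩
    rw [Function.iterate_succ_apply']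
    have := Convex.norm_image_sub_le_of_norm_hasFDerivWithin_le
      (f := (fwdDiff h)^[r] f) (s := Set.univ) (x := x) (y := x + h)
      (fun y _ => (hasFDerivAt_fwdDiff_iterate (hf.differentiable (by simp)) r h y).hasFDerivWithinAt)
      (fun y _ => hC h y) convex_univ trivial trivial
    simpa [fwdDiff, pow_succ, mul_assoc] using this

theorem fwdDiff_iterate_comp_affine {E F : Type*} [NormedAddCommGroup E] [NormedSpace ℝ E]
    [AddCommGroup F] (f : E → F) (a : ℝ) (y : E) (r : ℕ) (h x : E) :
    (fwdDiff h)^[r] (fun z => f (a • (z - y))) x = (fwdDiff (a • h))^[r] f (a • (x - y)) := by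
  induction r generalizing x with
  | zero => rfl
  | succ r ih =>
    rw [Function.iterate_succ_apply', Function.iterate_succ_apply']
    simp only [fwdDiff, ih]
    rw [add_sub_right_comm, smul_add]

/-- `f` and its differences of order `r` satisfy, on the whole plane, the bounds of a function
of smoothness `s`. -/
structure IsBesovBounded (s : ℝ) (r : ℕ) (f : Plane → ℝ) (C : ℝ) : Prop where
  bound : ∀ x, ‖f x‖ ≤ C
  diff : ∀ h, h ≠ 0 → ∀ x, ‖(fwdDiff h)^[r] f x‖ ≤ C * ‖h‖ ^ s

theorem IsBesovBounded.nonneg {s : ℝ} {r : ℕ} {f : Plane → ℝ} {C : ℝ}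
    (hf : IsBesovBounded s r f C) : 0 ≤ C :=
  (norm_nonneg _).trans (hf.bound 0)

/-- For `‖h‖ ≤ 1` the smooth bound `‖h‖ ^ r` is below `‖h‖ ^ s`; for `‖h‖ ≥ 1` the trivial bound by
the supremum of `f` suffices. -/
theorem exists_isBesovBounded {s : ℝ} {r : ℕ} (hs : 0 < s) (hr : s < r) {f : Plane → ℝ}
    (hf : ContDiff ℝ (⊤ : ℕ∞) f) (hc : HasCompactSupport f) :
    ∃ C, IsBesovBounded s r f C := by
  obtain ⟨C₀, h₀⟩ := hf.continuous.bounded_above_of_compact_support hc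
  obtain ⟨C₁, h₁⟩ := exists_norm_fwdDiff_iterate_le r hf hc
  have hC₀ : 0 ≤ C₀ := (norm_nonneg _).trans (h₀ 0)
  refine ⟨max (2 ^ r * C₀) |C₁|, fun x => ?_, fun h hh x => ?_⟩
  · refine (h₀ x).trans (le_max_of_le_left ?_)
    exact le_mul_of_one_le_left hC₀ (one_le_pow₀ one_le_two)
  · have hpos : 0 < ‖h‖ := norm_pos_iff.2 hh
    rcases le_total ‖h‖ 1 with h1 | h1
    · calc _ ≤ C₁ * ‖h‖ ^ r := h₁ h x
        _ ≤ max (2 ^ r * C₀) |C₁| * ‖h‖ ^ s := by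
          refine mul_le_mul ((le_abs_self _).trans (le_max_right _ _)) ?_ (by positivity)
            (by positivity)
          rw [← Real.rpow_natCast]
          exact Real.rpow_le_rpow_of_exponent_ge hpos h1 hr.le
    · calc _ ≤ 2 ^ r * C₀ := norm_fwdDiff_iterate_le_of_bound h₀ r h x
        _ ≤ max (2 ^ r * C₀) |C₁| * ‖h‖ ^ s := by
          refine (le_max_left _ |C₁|).trans (le_mul_of_one_le_right (by positivity) ?_)
          exact Real.one_le_rpow h1 hs.le

/-- Zooming by `t⁻¹` multiplies the smoothness bound by `t ^ (-s)`, which the amplitude `t ^ s`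
cancels exactly. The condition `t ≤ 1` serves only the supremum bound. -/
theorem IsBesovBounded.rescale {s : ℝ} {r : ℕ} {f : Plane → ℝ} {C t : ℝ} (hs : 0 < s)
    (hf : IsBesovBounded s r f C) (ht : 0 < t) (ht1 : t ≤ 1) (y : Plane) :
    IsBesovBounded s r (fun x => t ^ s * f (t⁻¹ • (x - y))) C := by
  refine ⟨fun x => ?_, fun h hh x => ?_⟩
  · rw [norm_mul, Real.norm_of_nonneg (by positivity)]
    exact (mul_le_of_le_one_left (norm_nonneg _) (Real.rpow_le_one ht.le ht1 hs.le)).trans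
      (hf.bound _)
  · have key : (fwdDiff h)^[r] (fun x => t ^ s * f (t⁻¹ • (x - y))) =
        t ^ s • (fwdDiff h)^[r] (fun x => f (t⁻¹ • (x - y))) :=
      fwdDiff_iter_const_smul h (t ^ s) (fun x => f (t⁻¹ • (x - y))) r
    rw [key, Pi.smul_apply, fwdDiff_iterate_comp_affine, norm_smul,
      Real.norm_of_nonneg (by positivity)]
    calc _ ≤ t ^ s * (C * ‖t⁻¹ • h‖ ^ s) := by
          gcongr
          exact hf.diff _ (smul_ne_zero (inv_ne_zero ht.ne') hh) _
      _ = C * ‖h‖ ^ s := by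
          rw [norm_smul, norm_inv, Real.norm_of_nonneg ht.le,
            Real.mul_rpow (by positivity) (by positivity), Real.inv_rpow ht.le]
          field_simp

theorem IsBesovBounded.add {s : ℝ} {r : ℕ} {f g : Plane → ℝ} {C D : ℝ}
    (hf : IsBesovBounded s r f C) (hg : IsBesovBounded s r g D) :
    IsBesovBounded s r (f + g) (C + D) := by
  refine ⟨fun x => (norm_add_le _ _).trans (add_le_add (hf.bound x) (hg.bound x)),
    fun h hh x => ?_⟩
  rw [fwdDiff_iter_add, Pi.add_apply, add_mul]
  exact (norm_add_le _ _).trans (add_le_add (hf.diff h hh x) (hg.diff h hh x))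

theorem IsBesovBounded.const_smul {s : ℝ} {r : ℕ} {f : Plane → ℝ} {C a : ℝ} (ha : 0 ≤ a)
    (hf : IsBesovBounded s r f C) : IsBesovBounded s r (a • f) (a * C) := by
  refine ⟨fun x => ?_, fun h hh x => ?_⟩
  · rw [Pi.smul_apply, norm_smul, Real.norm_of_nonneg ha]
    exact mul_le_mul_of_nonneg_left (hf.bound x) ha
  · rw [fwdDiff_iter_const_smul, Pi.smul_apply, norm_smul, Real.norm_of_nonneg ha, mul_assoc]
    exact mul_le_mul_of_nonneg_left (hf.diff h hh x) ha

theorem IsBesovBounded.mono {s : ℝ} {r : ℕ} {f : Plane → ℝ} {C D : ℝ}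
    (hf : IsBesovBounded s r f C) (h : C ≤ D) : IsBesovBounded s r f D :=
  ⟨fun x => (hf.bound x).trans h, fun k hk x => (hf.diff k hk x).trans (by gcongr)⟩

theorem IsBesovBounded.besovNorm_le {s : ℝ} {r : ℕ} {f : Plane → ℝ} {C : ℝ} (L : ℝ)
    (hf : IsBesovBounded s r f C) : besovNorm L s r f ≤ ENNReal.ofReal (2 * C) := by
  rw [two_mul, ENNReal.ofReal_add hf.nonneg hf.nonneg]
  refine add_le_add (iSup₂_le fun x _ => ?_) (iSup₂_le fun h hh => iSup₂_le fun x _ => ?_)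
  · rw [← ofReal_norm]
    exact ENNReal.ofReal_le_ofReal (hf.bound x)
  · refine ENNReal.div_le_of_le_mul ?_
    rw [← ENNReal.ofReal_mul hf.nonneg, ← ofReal_norm]
    exact ENNReal.ofReal_le_ofReal (hf.diff h hh x)

/-- The density of the reference law is controlled on `Ω` only, so sums involving it call for the
norm itself instead of `IsBesovBounded`. -/
theorem besovNorm_add_le (L s : ℝ) (r : ℕ) (f g : Plane → ℝ) :
    besovNorm L s r (f + g) ≤ besovNorm L s r f + besovNorm L s r g := by
  unfold besovNorm
  rw [add_add_add_comm]
  refine add_le_add (iSup₂_le fun x hx => ?_) (iSup₂_le fun h hh => iSup₂_le fun x hx => ?_)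
  · exact (enorm_add_le _ _).trans (add_le_add
      (le_iSup₂ (f := fun x (_ : x ∈ Omega L) => ‖f x‖ₑ) x hx)
      (le_iSup₂ (f := fun x (_ : x ∈ Omega L) => ‖g x‖ₑ) x hx))
  · rw [fwdDiff_iter_add, Pi.add_apply]
    refine (ENNReal.div_le_div_right (enorm_add_le _ _) _).trans ?_
    rw [ENNReal.add_div]
    exact add_le_add
      (le_iSup₂_of_le h hh (le_iSup₂_of_le x hx le_rfl))
      (le_iSup₂_of_le h hh (le_iSup₂_of_le x hx le_rfl))

theorem besovNorm_const_smul_le (L s : ℝ) (r : ℕ) {a : ℝ} (ha : ‖a‖ ≤ 1) (f : Plane → ℝ) :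
    besovNorm L s r (a • f) ≤ besovNorm L s r f := by
  have key (y : ℝ) : ‖a • y‖ₑ ≤ ‖y‖ₑ := by
    rw [← ofReal_norm, ← ofReal_norm, norm_smul]
    exact ENNReal.ofReal_le_ofReal (mul_le_of_le_one_left (norm_nonneg _) ha)
  unfold besovNorm
  refine add_le_add (iSup₂_mono fun x hx => key _) (iSup₂_mono fun h hh => iSup₂_mono fun x hx => ?_)
  rw [fwdDiff_iter_const_smul]
  exact ENNReal.div_le_div_right (key _) _

end Persistence

namespace Persistence

/-! ### The two-point method for mixtures -/

theorem lintegral_pi_prod {ι W : Type*} [Fintype ι] [MeasurableSpace W] (κ : Measure W)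
    [IsProbabilityMeasure κ] {f : ι → W → ℝ≥0∞} (hf : ∀ i, Measurable (f i)) :
    ∫⁻ D, ∏ i, f i (D i) ∂(Measure.pi fun _ : ι => κ) = ∏ i, ∫⁻ w, f i w ∂κ := by
  have hind := ProbabilityTheory.iIndepFun_pi (μ := fun _ : ι => κ) (X := f)
    (fun i => (hf i).aemeasurable)
  rw [ProbabilityTheory.lintegral_prod_eq_prod_lintegral_of_indepFun Finset.univ
    (fun i (D : ι → W) => f i (D i)) hind fun i => (hf i).comp (measurable_pi_apply i)]
  refine Finset.prod_congr rfl fun i _ => ?_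
  exact (measurePreserving_eval (fun _ : ι => κ) i).lintegral_comp (hf i)

theorem pi_withDensity {ι W : Type*} [Fintype ι] [MeasurableSpace W] (κ : Measure W)
    [IsProbabilityMeasure κ] {f : W → ℝ≥0∞} (hf : Measurable f)
    [IsProbabilityMeasure (κ.withDensity f)] :
    (Measure.pi fun _ : ι => κ.withDensity f) =
      (Measure.pi fun _ : ι => κ).withDensity fun D => ∏ i, f (D i) := by
  classical
  refine Measure.pi_eq fun A hA => ?_
  rw [withDensity_apply _ (MeasurableSet.univ_pi hA),
    ← lintegral_indicator (MeasurableSet.univ_pi hA)]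
  have : ∀ D : ι → W, (Set.univ.pi A).indicator (fun D => ∏ i, f (D i)) D =
      ∏ i, (A i).indicator f (D i) := by
    intro D
    by_cases hD : D ∈ Set.univ.pi A
    · rw [indicator_of_mem hD]
      exact Finset.prod_congr rfl fun i _ => (indicator_of_mem (hD i trivial) _).symm
    · rw [indicator_of_notMem hD]
      obtain ⟨i, hi⟩ : ∃ i, D i ∉ A i := by simpa [Set.mem_pi] using hD
      exact (Finset.prod_eq_zero (Finset.mem_univ i) (indicator_of_notMem hi _)).symm
  simp_rw [this]
  rw [lintegral_pi_prod κ fun i => hf.indicator (hA i)]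
  exact Finset.prod_congr rfl fun i _ => by
    rw [lintegral_indicator (hA i), withDensity_apply _ (hA i)]

/-- For `a ≥ 1` this is `(a - 2) ^ 2 ≥ 0`. It turns an upper bound on the second moment of a
likelihood ratio `F` into a lower bound on the affinity `∫ min 1 F`. -/
theorem le_min_one_add_sq_div_four (a : ℝ≥0∞) : a ≤ min 1 a + a ^ 2 / 4 := by
  rcases le_total a 1 with h | h
  · rw [min_eq_right h]
    exact le_self_add
  · rw [min_eq_left h]
    induction a with
    | top => simp [ENNReal.top_div]
    | coe x =>
      have : x ≤ 1 + x ^ 2 / 4 := by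
        rw [← NNReal.coe_le_coe]
        push_cast
        nlinarith [sq_nonneg ((x : ℝ) - 2)]
      have h4 : ((4 : NNReal) : ℝ≥0∞) = 4 := by norm_num
      rw [← h4, ← ENNReal.coe_pow, ← ENNReal.coe_div (by norm_num)]
      exact_mod_cast this

theorem one_add_inv_pow_le_three {n : ℕ} (hn : 1 ≤ n) :
    (1 + (n : ℝ≥0∞)⁻¹) ^ n ≤ 3 := by
  have hn0 : (0 : ℝ) < n := by exact_mod_cast hn
  have h1 : (1 + (n : ℝ≥0∞)⁻¹) = ENNReal.ofReal (1 + (n : ℝ)⁻¹) := by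
    rw [ENNReal.ofReal_add zero_le_one (by positivity), ENNReal.ofReal_one,
      ENNReal.ofReal_inv_of_pos hn0, ENNReal.ofReal_natCast]
  have h2 : (1 + (n : ℝ)⁻¹) ^ n ≤ 3 := by
    calc (1 + (n : ℝ)⁻¹) ^ n ≤ (Real.exp (n : ℝ)⁻¹) ^ n := by
          gcongr
          rw [add_comm]
          exact Real.add_one_le_exp _
      _ = Real.exp 1 := by rw [← Real.exp_nat_mul, mul_inv_cancel₀ hn0.ne']
      _ ≤ 3 := by linarith [Real.exp_one_lt_d9]
  rw [h1, ← ENNReal.ofReal_pow (by positivity)]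
  calc _ ≤ ENNReal.ofReal 3 := ENNReal.ofReal_le_ofReal h2
    _ = 3 := by norm_num

/-- Le Cam's two-point bound, with the affinity of the two product measures controlled by the
`χ²` divergence. -/
theorem two_point_bound {W : Type*} [MeasurableSpace W] (κ : Measure W)
    [IsProbabilityMeasure κ] {f : W → ℝ≥0∞} (hf : Measurable f) (hf1 : ∫⁻ w, f w ∂κ = 1)
    {n : ℕ} (hn : 1 ≤ n) (hf2 : ∫⁻ w, f w ^ 2 ∂κ ≤ 1 + (n : ℝ≥0∞)⁻¹)
    {A₀ A₁ : (Fin n → W) → ℝ≥0∞} (hA₀ : Measurable A₀) (hA₁ : Measurable A₁) {δ : ℝ≥0∞}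
    (hδ : ∀ D, δ ≤ A₀ D + A₁ D) :
    δ / 4 ≤ ∫⁻ D, A₀ D ∂(Measure.pi fun _ : Fin n => κ) +
      ∫⁻ D, A₁ D ∂(Measure.pi fun _ : Fin n => κ.withDensity f) := by
  have hprob : IsProbabilityMeasure (κ.withDensity f) :=
    ⟨by rw [withDensity_apply _ MeasurableSet.univ, Measure.restrict_univ, hf1]⟩
  set F : (Fin n → W) → ℝ≥0∞ := fun D => ∏ i, f (D i) with hFdef
  have hF : Measurable F :=
    Finset.measurable_fun_prod _ fun i _ => hf.comp (measurable_pi_apply i)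
  set π := Measure.pi fun _ : Fin n => κ with hπ
  have hF1 : ∫⁻ D, F D ∂π = 1 := by
    simp [hFdef, hπ, lintegral_pi_prod κ (fun _ : Fin n => hf), hf1]
  have hF2 : ∫⁻ D, F D ^ 2 ∂π ≤ 3 := by
    simp only [hFdef, ← Finset.prod_pow]
    rw [lintegral_pi_prod κ fun _ : Fin n => hf.pow_const 2]
    simp only [Finset.prod_const, Finset.card_univ, Fintype.card_fin]
    exact (pow_le_pow_left₀ (zero_le) hf2 n).trans (one_add_inv_pow_le_three hn)
  -- The mean of `F` is `1` and its second moment at most `3 < 4`, so the affinity keeps at least `1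
  -- - 3 / 4`.
  have hmin : 1 / 4 ≤ ∫⁻ D, min 1 (F D) ∂π := by
    have h1 : (1 : ℝ≥0∞) ≤ ∫⁻ D, min 1 (F D) ∂π + 3 / 4 := by
      calc (1 : ℝ≥0∞) = ∫⁻ D, F D ∂π := hF1.symm
        _ ≤ ∫⁻ D, (min 1 (F D) + F D ^ 2 / 4) ∂π :=
          lintegral_mono fun D => le_min_one_add_sq_div_four _
        _ = ∫⁻ D, min 1 (F D) ∂π + (∫⁻ D, F D ^ 2 ∂π) / 4 := by
          rw [lintegral_add_left (measurable_const.min hF)]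
          simp only [div_eq_mul_inv]
          rw [lintegral_mul_const _ (hF.pow_const 2)]
        _ ≤ _ := by gcongr
    have h2 : (1 : ℝ≥0∞) = 1 / 4 + 3 / 4 := by
      rw [← ENNReal.add_div, show (1 + 3 : ℝ≥0∞) = 4 by norm_num,
        ENNReal.div_self (by norm_num) (by norm_num)]
    refine (ENNReal.add_le_add_iff_right (a := 3 / 4) ?_).1 (h2.symm.trans_le h1)
    exact ENNReal.div_ne_top (by norm_num) (by norm_num)
  rw [pi_withDensity κ hf, lintegral_withDensity_eq_lintegral_mul _ hF hA₁,
    ← lintegral_add_left hA₀]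
  calc δ / 4 = δ * (1 / 4) := by rw [mul_one_div]
    _ ≤ δ * ∫⁻ D, min 1 (F D) ∂π := by gcongr
    _ = ∫⁻ D, δ * min 1 (F D) ∂π := (lintegral_const_mul _ (measurable_const.min hF)).symm
    _ ≤ ∫⁻ D, (A₀ D + (F * A₁) D) ∂π := by
      refine lintegral_mono fun D => ?_
      calc δ * min 1 (F D) ≤ (A₀ D + A₁ D) * min 1 (F D) := by gcongr; exact hδ D
        _ = A₀ D * min 1 (F D) + min 1 (F D) * A₁ D := by ring
        _ ≤ A₀ D * 1 + F D * A₁ D := by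
          gcongr
          · exact min_le_left _ _
          · exact min_le_right _ _
        _ = A₀ D + (F * A₁) D := by rw [mul_one, Pi.mul_apply]

/-- The mixture `(1 - ε) m + ε m'`. -/
noncomputable def mix {X : Type*} [MeasurableSpace X] (ε : ℝ) (m m' : Measure X) : Measure X :=
  ENNReal.ofReal (1 - ε) • m + ENNReal.ofReal ε • m'

theorem ofReal_one_sub_add_ofReal {ε : ℝ} (h0 : 0 ≤ ε) (h1 : ε ≤ 1) :
    ENNReal.ofReal (1 - ε) + ENNReal.ofReal ε = 1 := by
  rw [← ENNReal.ofReal_add (by linarith) h0]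
  simp

theorem lintegral_mix {X : Type*} [MeasurableSpace X] (ε : ℝ) (m m' : Measure X)
    (G : X → ℝ≥0∞) :
    ∫⁻ x, G x ∂(mix ε m m') =
      ENNReal.ofReal (1 - ε) * ∫⁻ x, G x ∂m + ENNReal.ofReal ε * ∫⁻ x, G x ∂m' := by
  rw [mix, lintegral_add_measure, lintegral_smul_measure, lintegral_smul_measure]
  simp

theorem isProbabilityMeasure_mix {X : Type*} [MeasurableSpace X] {ε : ℝ} (h0 : 0 ≤ ε)
    (h1 : ε ≤ 1) (m m' : Measure X) [IsProbabilityMeasure m] [IsProbabilityMeasure m'] :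
    IsProbabilityMeasure (mix ε m m') := by
  refine ⟨?_⟩
  rw [← lintegral_one, lintegral_mix]
  simpa using ofReal_one_sub_add_ofReal h0 h1

/-- Revealing which component each observation comes from can only help the statistician. On the
enlarged space the likelihood ratio is `1` on the common component and `f` on the other, so `m` and
`Q` need not be compared; the mixtures are images of the enlarged laws. -/
theorem two_point_bound_mix {X E : Type*} [MeasurableSpace X] [MeasurableSpace E]
    {ε : ℝ} (h0 : 0 ≤ ε) (h1 : ε ≤ 1) (m : Measure X) [IsProbabilityMeasure m]
    (Q : Measure E) [IsProbabilityMeasure Q] {S : E → X} (hS : Measurable S)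
    {f : E → ℝ≥0∞} (hf : Measurable f) (hf1 : ∫⁻ x, f x ∂Q = 1)
    {n : ℕ} (hn : 1 ≤ n) (hf2 : ∫⁻ x, f x ^ 2 ∂Q ≤ 1 + (n : ℝ≥0∞)⁻¹)
    {A₀ A₁ : (Fin n → X) → ℝ≥0∞} (hA₀ : Measurable A₀) (hA₁ : Measurable A₁) {δ : ℝ≥0∞}
    (hδ : ∀ D, δ ≤ A₀ D + A₁ D) :
    δ / 4 ≤ ∫⁻ D, A₀ D ∂(Measure.pi fun _ : Fin n => mix ε m (Q.map S)) +
      ∫⁻ D, A₁ D ∂(Measure.pi fun _ : Fin n => mix ε m ((Q.withDensity f).map S)) := by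
  have hprobQ : IsProbabilityMeasure (Q.withDensity f) :=
    ⟨by rw [withDensity_apply _ MeasurableSet.univ, Measure.restrict_univ, hf1]⟩
  -- The latent variable records whether an observation comes from `m` or from `Q`.
  let κ : Measure (X ⊕ E) := mix ε (m.map Sum.inl) (Q.map Sum.inr)
  let f' : X ⊕ E → ℝ≥0∞ := Sum.elim (fun _ => 1) f
  let p : X ⊕ E → X := Sum.elim id S
  have hf' : Measurable f' := measurable_const.sumElim hf
  have hp : Measurable p := measurable_id.sumElim hS
  have := Measure.isProbabilityMeasure_map (μ := m) (measurable_inl (β := E)).aemeasurable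
  have := Measure.isProbabilityMeasure_map (μ := Q) (measurable_inr (α := X)).aemeasurable
  have hκ : IsProbabilityMeasure κ := isProbabilityMeasure_mix h0 h1 _ _
  have hint (G : X ⊕ E → ℝ≥0∞) (hG : Measurable G) : ∫⁻ w, G w ∂κ =
      ENNReal.ofReal (1 - ε) * ∫⁻ x, G (Sum.inl x) ∂m +
        ENNReal.ofReal ε * ∫⁻ x, G (Sum.inr x) ∂Q := by
    rw [lintegral_mix, lintegral_map hG measurable_inl, lintegral_map hG measurable_inr]
  have hf'1 : ∫⁻ w, f' w ∂κ = 1 := by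
    rw [hint _ hf']
    simpa [f', hf1] using ofReal_one_sub_add_ofReal h0 h1
  have hf'2 : ∫⁻ w, f' w ^ 2 ∂κ ≤ 1 + (n : ℝ≥0∞)⁻¹ := by
    rw [hint _ (hf'.pow_const 2)]
    -- The divergence is in fact multiplied by `ε`; this gain is discarded.
    calc _ ≤ ENNReal.ofReal (1 - ε) * (1 + (n : ℝ≥0∞)⁻¹) +
          ENNReal.ofReal ε * (1 + (n : ℝ≥0∞)⁻¹) := by
          gcongr
          · simp [f']
          · exact hf2
      _ = 1 + (n : ℝ≥0∞)⁻¹ := by rw [← add_mul, ofReal_one_sub_add_ofReal h0 h1, one_mul]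
  have hprob : IsProbabilityMeasure (κ.withDensity f') :=
    ⟨by rw [withDensity_apply _ MeasurableSet.univ, Measure.restrict_univ, hf'1]⟩
  have map₀ : κ.map p = mix ε m (Q.map S) := by
    refine Measure.ext_of_lintegral _ fun G hG => ?_
    rw [lintegral_map hG hp]
    refine (hint _ (hG.comp hp)).trans ?_
    rw [lintegral_mix, lintegral_map hG hS]
    rfl
  have map₁ : (κ.withDensity f').map p = mix ε m ((Q.withDensity f).map S) := by
    refine Measure.ext_of_lintegral _ fun G hG => ?_
    rw [lintegral_map hG hp]
    refine (lintegral_withDensity_eq_lintegral_mul _ hf' (hG.comp hp)).trans ?_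
    rw [hint _ (hf'.mul (hG.comp hp)), lintegral_mix, lintegral_map hG hS]
    congr 2
    · simp [f', p]
    · exact (lintegral_withDensity_eq_lintegral_mul _ hf (hG.comp hS)).symm
  have hpn : Measurable fun (D : Fin n → X ⊕ E) i => p (D i) :=
    measurable_pi_lambda _ fun i => hp.comp (measurable_pi_apply i)
  have pi₀ : (Measure.pi fun _ : Fin n => mix ε m (Q.map S)) =
      (Measure.pi fun _ : Fin n => κ).map fun D i => p (D i) := by
    have : IsProbabilityMeasure (κ.map p) := Measure.isProbabilityMeasure_map hp.aemeasurable
    rw [← map₀]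
    exact (Measure.pi_map_pi fun _ => hp.aemeasurable).symm
  have pi₁ : (Measure.pi fun _ : Fin n => mix ε m ((Q.withDensity f).map S)) =
      (Measure.pi fun _ : Fin n => κ.withDensity f').map fun D i => p (D i) := by
    have : IsProbabilityMeasure ((κ.withDensity f').map p) :=
      Measure.isProbabilityMeasure_map hp.aemeasurable
    rw [← map₁]
    exact (Measure.pi_map_pi fun _ => hp.aemeasurable).symm
  rw [pi₀, pi₁, lintegral_map hA₀ hpn, lintegral_map hA₁ hpn]
  exact two_point_bound κ hf' hf'1 hn hf'2 (hA₀.comp hpn) (hA₁.comp hpn) fun D => hδ _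

end Persistence

namespace Persistence

/-! ### Persistence densities -/

theorem measurable_persSpace_apply {L M q : ℝ} {A : Set Plane} (hA : MeasurableSet A) :
    Measurable fun μ : PersSpace L M q => μ.1 A :=
  (Measure.measurable_coe hA).comp measurable_subtype_coe

theorem measurable_normalized_apply {L M q : ℝ} {A : Set Plane} (hA : MeasurableSet A) :
    Measurable fun μ : PersSpace L M q => normalized μ.1 A := by
  simp only [normalized, Measure.smul_apply, smul_eq_mul]
  exact (measurable_persSpace_apply MeasurableSet.univ).inv.mul (measurable_persSpace_apply hA)

theorem measurableSet_Omega (L : ℝ) : MeasurableSet (Omega L) := by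
  have h0 : Measurable fun x : Plane => x 0 := by fun_prop
  have h1 : Measurable fun x : Plane => x 1 := by fun_prop
  exact (measurableSet_lt measurable_const h0).inter
    ((measurableSet_lt h0 h1).inter (measurableSet_le h1 measurable_const))

theorem isPersistenceMeasure_dirac {L : ℝ} {x : Plane} (hx : x ∈ Omega L) :
    IsPersistenceMeasure L (Measure.dirac x) := by
  refine ⟨1, fun _ => x, fun _ _ => hx, ?_, fun K _ _ => measure_lt_top _ _⟩
  have : Unique {i : ℕ // (i : ℕ∞) < 1} :=
    { default := ⟨0, by simp⟩
      uniq := fun a => Subtype.ext (by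
        have h := a.2
        have : a.1 < 1 := by exact_mod_cast h
        change a.1 = 0
        omega) }
  refine Measure.ext fun s hs => ?_
  rw [Measure.sum_apply _ hs, tsum_fintype, Fintype.sum_unique]

/-- There is a disc in `Ω` all whose one-point diagrams have total persistence below `M`. -/
theorem exists_single {L M q : ℝ} (hL : 0 < L) (hM : 0 < M) (hq : 0 < q) :
    ∃ (y : Plane) (ρ : ℝ) (S : Plane → PersSpace L M q), 0 < ρ ∧
      Metric.closedBall y ρ ⊆ Omega L ∧ Measurable S ∧
      ∀ x ∈ Metric.closedBall y ρ, (S x).1 = Measure.dirac x := by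
  classical
  -- The total persistence of `δ_x` is the `q`-th power of the distance from `x` to the diagonal,
  -- hence the threshold `M ^ q⁻¹`.
  let U : Set Plane := {x | 0 < x 0 ∧ x 0 < x 1 ∧ x 1 < L ∧
    Metric.infDist x (diagonal L) < M ^ q⁻¹}
  have hU : IsOpen U := by
    have h0 : Continuous fun x : Plane => x 0 := by fun_prop
    have h1 : Continuous fun x : Plane => x 1 := by fun_prop
    exact (isOpen_lt continuous_const h0).inter ((isOpen_lt h0 h1).inter
      ((isOpen_lt h1 continuous_const).inter
        (isOpen_lt (Metric.continuous_infDist_pt _) continuous_const)))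
  have hMq : 0 < M ^ q⁻¹ := Real.rpow_pos_of_pos hM _
  obtain ⟨y, hy⟩ : U.Nonempty := by
    let c : Plane := !₂[L / 2, L / 2]
    let w : Plane := !₂[-1, 1]
    have hc : c ∈ diagonal L := ⟨rfl, by simp [c]; positivity, by simp [c]; linarith⟩
    have hw : 0 < ‖w‖ + 1 := by positivity
    -- The point is the midpoint of the diagonal, pushed off by `t • w`: `L / 4` keeps it inside the
    -- triangle, and the `+ 1` makes `t * ‖w‖ < M ^ q⁻¹` strict.
    set t := min (L / 4) (M ^ q⁻¹ / (‖w‖ + 1)) with ht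
    have ht0 : 0 < t := lt_min (by positivity) (by positivity)
    have ht1 : t ≤ L / 4 := min_le_left _ _
    have ht2 : t * (‖w‖ + 1) ≤ M ^ q⁻¹ := (le_div_iff₀ hw).1 (min_le_right _ _)
    refine ⟨c + t • w, ?_, ?_, ?_, ?_⟩
    · simp [c, w]; linarith
    · simp [c, w]; linarith
    · simp [c, w]; linarith
    · refine (Metric.infDist_le_dist_of_mem hc).trans_lt ?_
      rw [dist_self_add_left, norm_smul, Real.norm_of_nonneg ht0.le]
      nlinarith
  obtain ⟨ρ, hρ, hball⟩ := Metric.nhds_basis_closedBall.mem_iff.1 (hU.mem_nhds hy)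
  have hUO : ∀ x ∈ U, x ∈ Omega L := fun x hx => ⟨hx.1, hx.2.1, hx.2.2.1.le⟩
  have hUM : ∀ x ∈ U, IsPersistenceMeasure L (Measure.dirac x) ∧
      totalPersistence L q (Measure.dirac x) < ENNReal.ofReal M := by
    refine fun x hx => ⟨isPersistenceMeasure_dirac (hUO x hx), ?_⟩
    rw [totalPersistence, lintegral_dirac, ENNReal.ofReal_lt_ofReal_iff hM]
    calc _ < (M ^ q⁻¹) ^ q := Real.rpow_lt_rpow Metric.infDist_nonneg hx.2.2.2 hq
      _ = M := Real.rpow_inv_rpow hM.le hq.ne'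
  -- Points outside `U` are sent to `y`, so that the map to diagrams is defined and measurable on
  -- the whole plane.
  let g : Plane → Plane := fun x => if x ∈ U then x else y
  have hg : ∀ x, g x ∈ U := fun x => by
    by_cases hx : x ∈ U
    · simp [g, hx]
    · simp [g, hx, hy]
  have hgm : Measurable g := Measurable.ite hU.measurableSet measurable_id measurable_const
  refine ⟨y, ρ, fun x => ⟨Measure.dirac (g x), hUM _ (hg x)⟩, hρ, fun x hx => hUO x (hball hx),
    (Measure.measurable_dirac.comp hgm).subtype_mk, fun x hx => ?_⟩
  simp [g, hball hx]

/-- The law of a one-point diagram whose point has density `g`. -/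
noncomputable def singleLaw {L M q : ℝ} (S : Plane → PersSpace L M q) (g : Plane → ℝ) :
    Measure (PersSpace L M q) :=
  (volume.withDensity fun x => ENNReal.ofReal (g x)).map S

theorem isProbabilityMeasure_withDensity_ofReal {g : Plane → ℝ}
    (hg1 : ∫⁻ x, ENNReal.ofReal (g x) = 1) :
    IsProbabilityMeasure (volume.withDensity fun x => ENNReal.ofReal (g x)) :=
  ⟨by rw [withDensity_apply _ MeasurableSet.univ, Measure.restrict_univ, hg1]⟩

theorem isProbabilityMeasure_singleLaw {L M q : ℝ} {S : Plane → PersSpace L M q}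
    (hS : Measurable S) {g : Plane → ℝ} (hg1 : ∫⁻ x, ENNReal.ofReal (g x) = 1) :
    IsProbabilityMeasure (singleLaw S g) :=
  have := isProbabilityMeasure_withDensity_ofReal hg1
  Measure.isProbabilityMeasure_map hS.aemeasurable

/-- Since `δ_x` has mass `1`, the expected normalized measure is the law of the point. Outside `K`
the values of `S` are unknown, but `g` vanishes there. -/
theorem isPersistenceDensity_of_eq_singleLaw {L M q : ℝ} {S : Plane → PersSpace L M q}
    (hS : Measurable S) {K : Set Plane} (hSK : ∀ x ∈ K, (S x).1 = Measure.dirac x)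
    {g : Plane → ℝ} (hg : Measurable g) (hg0 : ∀ x, 0 ≤ g x) (hgK : ∀ x ∉ K, g x = 0)
    {P : ProbabilityMeasure (PersSpace L M q)}
    (hP : (P : Measure (PersSpace L M q)) = singleLaw S g) : IsPersistenceDensity P g := by
  have hint (G : PersSpace L M q → ℝ≥0∞) (hG : Measurable G) :
      ∫⁻ μ, G μ ∂(P : Measure (PersSpace L M q)) = ∫⁻ x, ENNReal.ofReal (g x) * G (S x) := by
    rw [hP, singleLaw, lintegral_map hG hS]
    exact lintegral_withDensity_eq_lintegral_mul _ hg.ennreal_ofReal (hG.comp hS)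
  refine ⟨?_, hg.aemeasurable, fun x _ => hg0 x, fun A hA hAm => ?_⟩
  · have hm : MeasurableSet {μ : PersSpace L M q | 0 < μ.1 univ ∧ μ.1 univ < ∞} :=
      (measurableSet_lt measurable_const (measurable_persSpace_apply MeasurableSet.univ)).inter
        (measurableSet_lt (measurable_persSpace_apply MeasurableSet.univ) measurable_const)
    change (P : Measure (PersSpace L M q)) {μ | 0 < μ.1 univ ∧ μ.1 univ < ∞}ᶜ = 0
    rw [← lintegral_indicator_one hm.compl, hint _ (measurable_one.indicator hm.compl)]
    refine (lintegral_congr fun x => ?_).trans lintegral_zero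
    by_cases hx : x ∈ K
    · rw [indicator_of_notMem, mul_zero]
      simp [hSK x hx]
    · rw [hgK x hx, ENNReal.ofReal_zero, zero_mul]
  · rw [hint _ (measurable_normalized_apply hAm), ← lintegral_indicator hAm]
    refine lintegral_congr fun x => ?_
    by_cases hx : x ∈ K
    · by_cases hxA : x ∈ A <;> simp [normalized, hSK x hx, hxA, hAm]
    · simp [hgK x hx, indicator]

/-- Each diagram is normalized separately, before the expectation, so the expected measure is affine
in the law. -/
theorem IsPersistenceDensity.mix {L M q ε : ℝ} (h0 : 0 ≤ ε) (h1 : ε ≤ 1)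
    {P P' P'' : ProbabilityMeasure (PersSpace L M q)} {p p' : Plane → ℝ}
    (hp : IsPersistenceDensity P p) (hp' : IsPersistenceDensity P' p')
    (hP : (P'' : Measure (PersSpace L M q)) = Persistence.mix ε P P') :
    IsPersistenceDensity P'' ((1 - ε) • p + ε • p') := by
  have h1' : 0 ≤ 1 - ε := by linarith
  refine ⟨?_, ?_, fun x hx => ?_, fun A hA hAm => ?_⟩
  · rw [hP, Persistence.mix, ae_add_measure_iff]
    exact ⟨Measure.ae_smul_measure hp.finite_nonempty _,
      Measure.ae_smul_measure hp'.finite_nonempty _⟩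
  · exact (hp.aemeasurable.const_smul _).add (hp'.aemeasurable.const_smul _)
  · exact add_nonneg (mul_nonneg h1' (hp.nonneg x hx)) (mul_nonneg h0 (hp'.nonneg x hx))
  · rw [hP, lintegral_mix, hp.density A hA hAm, hp'.density A hA hAm]
    have hm : AEMeasurable p (volume.restrict A) :=
      hp.aemeasurable.mono_measure (Measure.restrict_mono hA le_rfl)
    have hm' : AEMeasurable p' (volume.restrict A) :=
      hp'.aemeasurable.mono_measure (Measure.restrict_mono hA le_rfl)
    rw [← lintegral_const_mul'' _ hm.ennreal_ofReal, ← lintegral_const_mul'' _ hm'.ennreal_ofReal,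
      ← lintegral_add_left' (hm.ennreal_ofReal.const_mul _)]
    refine setLIntegral_congr_fun hAm fun x hx => ?_
    simp only [Pi.add_apply, Pi.smul_apply, smul_eq_mul]
    rw [ENNReal.ofReal_add (mul_nonneg h1' (hp.nonneg x (hA hx)))
      (mul_nonneg h0 (hp'.nonneg x (hA hx))), ENNReal.ofReal_mul h1', ENNReal.ofReal_mul h0]

/-! ### Pointwise lower bound for the risk -/

/-- By continuity, a value above the essential supremum would be exceeded on a neighbourhood, which
has positive measure. -/
theorem enorm_le_eLpNorm_top_of_mem_interior {L : ℝ} {f : Plane → ℝ}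
    (hf : ContinuousOn f (Omega L)) {y : Plane} (hy : y ∈ interior (Omega L)) :
    ‖f y‖ₑ ≤ eLpNorm f ∞ (volume.restrict (Omega L)) := by
  rw [eLpNorm_exponent_top]
  by_contra! hlt
  have hcont : ContinuousAt (fun x => ‖f x‖ₑ) y :=
    (hf.continuousAt (mem_interior_iff_mem_nhds.1 hy)).enorm
  have hnhds : {x | eLpNormEssSup f (volume.restrict (Omega L)) < ‖f x‖ₑ} ∩ Omega L ∈ nhds y :=
    Filter.inter_mem (hcont.eventually (lt_mem_nhds hlt)) (mem_interior_iff_mem_nhds.1 hy)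
  have hpos := Measure.measure_pos_of_mem_nhds volume hnhds
  have hae := ae_le_eLpNormEssSup (f := f) (μ := volume.restrict (Omega L))
  rw [ae_restrict_iff' (measurableSet_Omega L)] at hae
  refine hpos.ne' (measure_mono_null ?_ hae)
  rintro x ⟨hx, hxO⟩ hle
  exact absurd (hle hxO) (not_le.2 hx)

theorem lintegral_enorm_sub_le_risk {L M q s B : ℝ} {r n : ℕ}
    {T : (Fin n → PersSpace L M q) → Plane → ℝ} (hT : IsEstimator s r B n T)
    {P : ProbabilityMeasure (PersSpace L M q)} {p : Plane → ℝ} (hp : ContinuousOn p (Omega L))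
    {y : Plane} (hy : y ∈ interior (Omega L)) :
    ∫⁻ D, ‖T D y - p y‖ₑ ∂(Measure.pi fun _ : Fin n => (P : Measure (PersSpace L M q))) ≤
      risk T P p :=
  lintegral_mono fun D =>
    enorm_le_eLpNorm_top_of_mem_interior (f := fun x => T D x - p x) ((hT.mem_ball D).1.sub hp) hy

/-! ### The base density and its perturbations -/

/-- A smooth density on a disc, constant on the concentric disc of half the radius. -/
theorem exists_base_density (y : Plane) {ρ : ℝ} (hρ : 0 < ρ) :
    ∃ (g : Plane → ℝ) (a : ℝ), ContDiff ℝ (⊤ : ℕ∞) g ∧ HasCompactSupport g ∧ (∀ x, 0 ≤ g x) ∧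
      ∫ x, g x = 1 ∧ (∀ x ∉ Metric.closedBall y ρ, g x = 0) ∧ 0 < a ∧
      ∀ x ∈ Metric.closedBall y (ρ / 2), g x = a := by
  let b : ContDiffBump y := ⟨ρ / 2, ρ, by positivity, by linarith⟩
  refine ⟨b.normed volume, 1 / ∫ x, b x, b.contDiff_normed, b.hasCompactSupport_normed,
    b.nonneg_normed, b.integral_normed, fun x hx => ?_, one_div_pos.2 b.integral_pos,
    fun x hx => ?_⟩
  · rw [b.normed_def, b.zero_of_le_dist (not_le.1 hx).le, zero_div]
  · rw [b.normed_def, b.one_of_mem_closedBall hx]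

/-- A smooth compactly supported function with integral zero. -/
theorem exists_perturbation :
    ∃ φ : Plane → ℝ, ContDiff ℝ (⊤ : ℕ∞) φ ∧ HasCompactSupport φ ∧ (∀ x, |φ x| ≤ 1) ∧ φ 0 = 1 ∧
      ∫ x, φ x = 0 ∧ ∀ x ∉ Metric.closedBall (0 : Plane) 3, φ x = 0 := by
  -- `φ` is a bump of radius `1` minus its translate by a vector of norm `2`: the translate vanishes
  -- at `0`, the integrals cancel, and the support has radius at most `2 + 1`.
  let b : ContDiffBump (0 : Plane) := ⟨1 / 2, 1, by positivity, by norm_num⟩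
  obtain ⟨v, hv⟩ := exists_norm_eq Plane zero_le_two
  have hb : ∀ x : Plane, 1 ≤ ‖x‖ → b x = 0 := fun x hx =>
    b.zero_of_le_dist (by rwa [dist_zero_right])
  have hsupp : ∀ x ∉ Metric.closedBall (0 : Plane) 3, b x - b (x - v) = 0 := by
    intro x hx
    rw [mem_closedBall_zero_iff, not_le] at hx
    rw [hb x (by linarith), hb (x - v) (by linarith [norm_sub_norm_le x v]), sub_zero]
  refine ⟨fun x => b x - b (x - v), ?_, ?_, fun x => ?_, ?_, ?_, hsupp⟩
  · exact b.contDiff.sub (b.contDiff.comp (contDiff_id.sub contDiff_const))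
  · exact HasCompactSupport.intro (isCompact_closedBall (0 : Plane) 3) hsupp
  · rw [abs_le]
    constructor <;> linarith [b.nonneg (x := x), b.nonneg (x := x - v), b.le_one (x := x),
      b.le_one (x := x - v)]
  · have h1 : b 0 = 1 := b.one_of_mem_closedBall (Metric.mem_closedBall_self b.rIn_pos.le)
    simp only
    rw [h1, hb (0 - v) (by simp [hv]), sub_zero]
  · rw [integral_sub b.integrable (b.integrable.comp_sub_right v), integral_sub_right_eq_self,
      sub_self]

end Persistence

namespace Persistence

/-! ### The minimax lower bound -/

theorem integral_rescale (f : Plane → ℝ) {t : ℝ} (ht : 0 < t) (y : Plane) :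
    ∫ x, f (t⁻¹ • (x - y)) = t ^ 2 * ∫ x, f x := by
  rw [integral_sub_right_eq_self (fun x => f (t⁻¹ • x)) y,
    Measure.integral_comp_inv_smul_of_nonneg volume f ht.le]
  simp

/-- If some distribution has a continuous density of Besov norm below `B`, no estimator beats the
rate `n ^ (-s / (2 (s + 1)))` on the Besov ball of radius `B`. -/
theorem exists_le_iSup_risk {L M q s B : ℝ} {r : ℕ} (hL : 0 < L) (hM : 0 < M) (hq : 0 < q)
    (hs : 0 < s) (hr : s < r) {P : ProbabilityMeasure (PersSpace L M q)} {p : Plane → ℝ}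
    (hP : IsPersistenceDensity P p) (hpc : ContinuousOn p (Omega L))
    (hpB : besovNorm L s r p < ENNReal.ofReal B) :
    ∃ c : ℝ, 0 < c ∧ ∀ n : ℕ, 1 ≤ n → ∀ (B' : ℝ) (T : (Fin n → PersSpace L M q) → Plane → ℝ),
      IsEstimator s r B' n T → ENNReal.ofReal (c * (n : ℝ) ^ (-(s / (2 * (s + 1))))) ≤
        ⨆ (P : ProbabilityMeasure (PersSpace L M q)) (p : Plane → ℝ)
          (_ : IsPersistenceDensity P p ∧ p ∈ besovBall L s r B), risk T P p := by
  obtain ⟨y, ρ, S, hρ, hball, hS, hSx⟩ := exists_single (L := L) (M := M) (q := q) hL hM hq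
  obtain ⟨g, a, hgs, hgc, hg0, hg1, hgK, ha, hga⟩ := exists_base_density y hρ
  obtain ⟨φ, hφs, hφc, hφ1, hφ0, hφint, hφK⟩ := exists_perturbation
  obtain ⟨Cg, hCg⟩ := exists_isBesovBounded hs hr hgs hgc
  obtain ⟨Cφ, hCφ⟩ := exists_isBesovBounded hs hr hφs hφc
  have hCg0 := hCg.nonneg
  have hCφ0 := hCφ.nonneg
  have hyint : y ∈ interior (Omega L) :=
    mem_interior_iff_mem_nhds.2 (Filter.mem_of_superset (Metric.closedBall_mem_nhds y hρ) hball)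
  -- the weight of the mixture
  obtain ⟨ε, hε, hε1, hεB⟩ : ∃ ε : ℝ, 0 < ε ∧ ε ≤ 1 ∧
      besovNorm L s r p + ENNReal.ofReal (2 * (ε * (Cg + a * Cφ))) ≤ ENNReal.ofReal B := by
    set b := besovNorm L s r p with hb
    have hbtop : b ≠ ∞ := (hpB.trans ENNReal.ofReal_lt_top).ne
    have hbB : b.toReal < B := (ENNReal.lt_ofReal_iff_toReal_lt hbtop).1 hpB
    have hden : 0 < 2 * (Cg + a * Cφ) + 1 := by positivity
    -- The mixture may use the slack `B - ‖p‖`. The factor `2` comes from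
    -- `IsBesovBounded.besovNorm_le`; the `+ 1` keeps the denominator positive.
    refine ⟨min 1 ((B - b.toReal) / (2 * (Cg + a * Cφ) + 1)),
      lt_min one_pos (div_pos (by linarith) hden), min_le_left _ _, ?_⟩
    set ε := min 1 ((B - b.toReal) / (2 * (Cg + a * Cφ) + 1)) with hεdef
    have hε : 0 < ε := lt_min one_pos (div_pos (by linarith) hden)
    have hε2 : ε * (2 * (Cg + a * Cφ) + 1) ≤ B - b.toReal :=
      (le_div_iff₀ hden).1 (min_le_right _ _)
    rw [← ENNReal.ofReal_toReal hbtop, ← ENNReal.ofReal_add ENNReal.toReal_nonneg (by positivity)]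
    exact ENNReal.ofReal_le_ofReal (by linarith)
  have hmem : ∀ f : Plane → ℝ, Continuous f → IsBesovBounded s r f (Cg + a * Cφ) →
      (1 - ε) • p + ε • f ∈ besovBall L s r B := by
    refine fun f hfc hf => ⟨(hpc.const_smul _).add (hfc.const_smul _).continuousOn, ?_⟩
    refine (besovNorm_add_le _ _ _ _ _).trans ((add_le_add ?_ ?_).trans hεB)
    · refine besovNorm_const_smul_le _ _ _ ?_ _
      rw [Real.norm_of_nonneg (by linarith)]
      linarith
    · exact (hf.const_smul hε.le).besovNorm_le L
  -- the scale of the perturbation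
  set V := ∫ x, φ x ^ 2 with hV
  have hV0 : 0 ≤ V := integral_nonneg fun x => sq_nonneg _
  obtain ⟨t₀, ht₀, ht₀1, ht₀ρ, ht₀V⟩ : ∃ t₀ : ℝ, 0 < t₀ ∧ t₀ ≤ 1 ∧ 3 * t₀ ≤ ρ / 2 ∧
      a * (t₀ * V) ≤ 1 := by
    have hden : 0 < a * V + 1 := by positivity
    -- `1` allows the rescaling, `ρ / 6` puts the support of `u`, of radius at most `3 t`, where `g`
    -- is constant, and the last term brings the `χ²` divergence below `1 / n`.
    refine ⟨min 1 (min (ρ / 6) (1 / (a * V + 1))),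
      lt_min one_pos (lt_min (by positivity) (by positivity)), min_le_left _ _, ?_, ?_⟩
    · linarith [(min_le_right 1 (min (ρ / 6) (1 / (a * V + 1)))).trans (min_le_left _ _)]
    · have h1 := (min_le_right 1 (min (ρ / 6) (1 / (a * V + 1)))).trans (min_le_right _ _)
      have h2 := (le_div_iff₀ hden).1 h1
      have h3 : 0 < min 1 (min (ρ / 6) (1 / (a * V + 1))) :=
        lt_min one_pos (lt_min (by positivity) (by positivity))
      nlinarith
  -- The separation `ε a t ^ s` loses a factor `4` in the two-point bound and a factor `2` because
  -- the sum of two risks is at most twice their supremum.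
  refine ⟨ε * a * t₀ ^ s / 8, by positivity, fun n hn B' T hT => ?_⟩
  have hn0 : (0 : ℝ) < n := by exact_mod_cast hn
  have hn1 : (1 : ℝ) ≤ n := by exact_mod_cast hn
  -- This makes `t ^ (2 * (s + 1))` proportional to `1 / n`; the exponent adds `2 s` from the
  -- squared amplitude and `2` from the dimension of the plane.
  set t := t₀ * (n : ℝ) ^ (-(1 / (2 * (s + 1)))) with ht_def
  have ht : 0 < t := by positivity
  have htt₀ : t ≤ t₀ := mul_le_of_le_one_right ht₀.le
    (Real.rpow_le_one_of_one_le_of_nonpos hn1 (neg_nonpos.2 (by positivity)))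
  have ht1 : t ≤ 1 := htt₀.trans ht₀1
  have hts : t ^ s = t₀ ^ s * (n : ℝ) ^ (-(s / (2 * (s + 1)))) := by
    rw [ht_def, Real.mul_rpow ht₀.le (by positivity), ← Real.rpow_mul hn0.le]
    congr 2
    ring
  have htV : a * ((t ^ s) ^ 2 * (t ^ 2 * V)) ≤ (n : ℝ)⁻¹ := by
    have h1 : (t ^ s) ^ 2 * t ^ 2 = t ^ (2 * (s + 1)) := by
      rw [← mul_pow, ← Real.rpow_add_one ht.ne', ← Real.rpow_natCast, ← Real.rpow_mul ht.le]
      congr 1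
      push_cast
      ring
    have h2 : t ^ (2 * (s + 1)) = t₀ ^ (2 * (s + 1)) * (n : ℝ)⁻¹ := by
      rw [ht_def, Real.mul_rpow ht₀.le (by positivity), ← Real.rpow_mul hn0.le,
        ← Real.rpow_neg_one]
      congr 2
      field_simp
    have h3 : t₀ ^ (2 * (s + 1)) ≤ t₀ := by
      calc _ ≤ t₀ ^ (1 : ℝ) := Real.rpow_le_rpow_of_exponent_ge ht₀ ht₀1 (by linarith)
        _ = t₀ := Real.rpow_one _
    calc a * ((t ^ s) ^ 2 * (t ^ 2 * V)) = a * (t₀ ^ (2 * (s + 1)) * V) * (n : ℝ)⁻¹ := by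
          rw [← mul_assoc (_ ^ 2), h1, h2]; ring
      _ ≤ a * (t₀ * V) * (n : ℝ)⁻¹ := by gcongr
      _ ≤ 1 * (n : ℝ)⁻¹ := by gcongr
      _ = (n : ℝ)⁻¹ := one_mul _
  -- the perturbation
  set u : Plane → ℝ := fun x => t ^ s * φ (t⁻¹ • (x - y)) with hu
  have hφcont := hφs.continuous
  have hucont : Continuous u := by fun_prop
  have hu1 : ∀ x, |u x| ≤ 1 := fun x => by
    rw [hu, abs_mul, abs_of_nonneg (by positivity)]
    exact mul_le_one₀ (Real.rpow_le_one ht.le ht1 hs.le) (abs_nonneg _) (hφ1 _)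
  have huy : u y = t ^ s := by simp [hu, hφ0]
  have huK : ∀ x ∉ Metric.closedBall y (ρ / 2), u x = 0 := by
    intro x hx
    have : φ (t⁻¹ • (x - y)) = 0 := by
      refine hφK _ fun hmem => hx ?_
      rw [mem_closedBall_zero_iff, norm_smul, norm_inv, Real.norm_of_nonneg ht.le,
        inv_mul_le_iff₀ ht] at hmem
      rw [mem_closedBall_iff_norm]
      linarith
    rw [hu]
    simp [this]
  have hucs : HasCompactSupport u := HasCompactSupport.intro (isCompact_closedBall y (ρ / 2)) huK
  -- As `g = a` wherever `u ≠ 0`, the perturbation is both additive, `g + a u`, as the Besov bounds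
  -- require, and multiplicative, `g (1 + u)`, as the likelihood ratio requires.
  have hgu : ∀ x, g x * u x = a * u x := fun x => by
    by_cases hx : x ∈ Metric.closedBall y (ρ / 2)
    · rw [hga x hx]
    · simp [huK x hx]
  have huint : ∫ x, u x = 0 := by
    rw [hu, integral_const_mul, integral_rescale φ ht, hφint, mul_zero, mul_zero]
  have hu2int : ∫ x, u x ^ 2 = (t ^ s) ^ 2 * (t ^ 2 * V) := by
    simp only [hu, mul_pow]
    rw [integral_const_mul, integral_rescale (fun x => φ x ^ 2) ht]
  have huI : Integrable u := hucont.integrable_of_hasCompactSupport hucs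
  have hu2I : Integrable fun x => u x ^ 2 :=
    (hucont.pow 2).integrable_of_hasCompactSupport
      (HasCompactSupport.intro hucs fun x hx => by
        simp [image_eq_zero_of_notMem_tsupport hx])
  have hgI : Integrable g := hgs.continuous.integrable_of_hasCompactSupport hgc
  set g₁ : Plane → ℝ := g + a • u with hg₁
  have hg₁eq : ∀ x, g₁ x = g x * (1 + u x) := fun x => by
    simp only [hg₁, Pi.add_apply, Pi.smul_apply, smul_eq_mul, mul_add, mul_one, hgu]
  have hu0 : ∀ x, 0 ≤ 1 + u x := fun x => by linarith [(abs_le.1 (hu1 x)).1]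
  have hg₁0 : ∀ x, 0 ≤ g₁ x := fun x => by
    rw [hg₁eq]
    exact mul_nonneg (hg0 x) (hu0 x)
  have hg₁K : ∀ x ∉ Metric.closedBall y ρ, g₁ x = 0 := fun x hx => by
    rw [hg₁eq, hgK x hx, zero_mul]
  have hg₁cont : Continuous g₁ := hgs.continuous.add (hucont.const_smul a)
  have hg₁I : Integrable g₁ := hgI.add (huI.smul a)
  have hg₁int : ∫ x, g₁ x = 1 := by
    simp only [hg₁, Pi.add_apply, Pi.smul_apply, smul_eq_mul]
    rw [integral_add hgI (huI.const_mul a), hg1, integral_const_mul, huint]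
    simp
  have hlg : ∫⁻ x, ENNReal.ofReal (g x) = 1 := by
    rw [← ofReal_integral_eq_lintegral_ofReal hgI (ae_of_all _ hg0), hg1, ENNReal.ofReal_one]
  have hlg₁ : ∫⁻ x, ENNReal.ofReal (g₁ x) = 1 := by
    rw [← ofReal_integral_eq_lintegral_ofReal hg₁I (ae_of_all _ hg₁0), hg₁int, ENNReal.ofReal_one]
  -- the likelihood ratio
  set Q : Measure Plane := volume.withDensity fun x => ENNReal.ofReal (g x) with hQ
  set f : Plane → ℝ≥0∞ := fun x => ENNReal.ofReal (1 + u x) with hf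
  have hfm : Measurable f := (continuous_const.add hucont).measurable.ennreal_ofReal
  have hgm : Measurable fun x => ENNReal.ofReal (g x) := hgs.continuous.measurable.ennreal_ofReal
  have hQf : Q.withDensity f = volume.withDensity fun x => ENNReal.ofReal (g₁ x) := by
    rw [hQ, ← withDensity_mul _ hgm hfm]
    congr 1
    funext x
    rw [Pi.mul_apply, hf, hg₁eq, ENNReal.ofReal_mul (hg0 x)]
  have hf1 : ∫⁻ x, f x ∂Q = 1 := by
    rw [← setLIntegral_univ, ← withDensity_apply _ MeasurableSet.univ, hQf,
      withDensity_apply _ MeasurableSet.univ, setLIntegral_univ, hlg₁]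
  have hf2 : ∫⁻ x, f x ^ 2 ∂Q ≤ 1 + (n : ℝ≥0∞)⁻¹ := by
    have hI' : Integrable fun x => g x + 2 * a * u x := hgI.add (huI.const_mul _)
    have hI : Integrable fun x => g x + 2 * a * u x + a * u x ^ 2 := hI'.add (hu2I.const_mul _)
    -- The linear term integrates to zero, so only the quadratic one contributes to the divergence.
    have heq : ∀ x, g x * (1 + u x) ^ 2 = g x + 2 * a * u x + a * u x ^ 2 := fun x => by
      linear_combination (2 + u x) * hgu x
    calc ∫⁻ x, f x ^ 2 ∂Q
        = ∫⁻ x, ENNReal.ofReal (g x + 2 * a * u x + a * u x ^ 2) := by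
          rw [hQ, lintegral_withDensity_eq_lintegral_mul _ hgm (hfm.pow_const 2)]
          refine lintegral_congr fun x => ?_
          rw [← heq, ENNReal.ofReal_mul (hg0 x), ENNReal.ofReal_pow (hu0 x), Pi.mul_apply]
      _ = ENNReal.ofReal (1 + a * ((t ^ s) ^ 2 * (t ^ 2 * V))) := by
          rw [← ofReal_integral_eq_lintegral_ofReal hI (ae_of_all _ fun x =>
              (mul_nonneg (hg0 x) (sq_nonneg _)).trans_eq (heq x)),
            integral_add hI' (hu2I.const_mul _),
            integral_add hgI (huI.const_mul _), integral_const_mul (2 * a) u,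
            integral_const_mul a fun x => u x ^ 2, hg1,
            huint, hu2int, mul_zero, add_zero]
      _ ≤ ENNReal.ofReal (1 + (n : ℝ)⁻¹) := ENNReal.ofReal_le_ofReal (by linarith)
      _ = 1 + (n : ℝ≥0∞)⁻¹ := by
          rw [ENNReal.ofReal_add zero_le_one (by positivity), ENNReal.ofReal_one,
            ENNReal.ofReal_inv_of_pos hn0, ENNReal.ofReal_natCast]
  -- the two distributions
  have hprobQ : IsProbabilityMeasure Q := isProbabilityMeasure_withDensity_ofReal hlg
  let R₀ : ProbabilityMeasure (PersSpace L M q) :=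
    ⟨singleLaw S g, isProbabilityMeasure_singleLaw hS hlg⟩
  let R₁ : ProbabilityMeasure (PersSpace L M q) :=
    ⟨singleLaw S g₁, isProbabilityMeasure_singleLaw hS hlg₁⟩
  let P₀ : ProbabilityMeasure (PersSpace L M q) :=
    ⟨mix ε P R₀, isProbabilityMeasure_mix hε.le hε1 _ _⟩
  let P₁ : ProbabilityMeasure (PersSpace L M q) :=
    ⟨mix ε P R₁, isProbabilityMeasure_mix hε.le hε1 _ _⟩
  have hP₀ : IsPersistenceDensity P₀ ((1 - ε) • p + ε • g) :=
    IsPersistenceDensity.mix (P' := R₀) hε.le hε1 hP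
      (isPersistenceDensity_of_eq_singleLaw hS hSx hgs.continuous.measurable hg0 hgK rfl) rfl
  have hP₁ : IsPersistenceDensity P₁ ((1 - ε) • p + ε • g₁) :=
    IsPersistenceDensity.mix (P' := R₁) hε.le hε1 hP
      (isPersistenceDensity_of_eq_singleLaw hS hSx hg₁cont.measurable hg₁0 hg₁K rfl) rfl
  have hB₀ := hmem g hgs.continuous (hCg.mono (by nlinarith))
  have hB₁ := hmem g₁ hg₁cont (hCg.add ((hCφ.rescale hs ht ht1 y).const_smul ha.le))
  set p₀ := (1 - ε) • p + ε • g with hp₀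
  set p₁ := (1 - ε) • p + ε • g₁ with hp₁
  set Φ := ⨆ (P : ProbabilityMeasure (PersSpace L M q)) (p : Plane → ℝ)
    (_ : IsPersistenceDensity P p ∧ p ∈ besovBall L s r B), risk T P p with hΦ
  have hΦ₀ : risk T P₀ p₀ ≤ Φ :=
    le_iSup₂_of_le P₀ p₀ (le_iSup_of_le ⟨hP₀, hB₀⟩ le_rfl)
  have hΦ₁ : risk T P₁ p₁ ≤ Φ :=
    le_iSup₂_of_le P₁ p₁ (le_iSup_of_le ⟨hP₁, hB₁⟩ le_rfl)
  have hTm := hT.measurable y (interior_subset hyint)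
  have htwo := two_point_bound_mix hε.le hε1 (P : Measure (PersSpace L M q)) Q hS hfm hf1 hn hf2
    (A₀ := fun D => ‖T D y - p₀ y‖ₑ) (A₁ := fun D => ‖T D y - p₁ y‖ₑ)
    (hTm.sub_const _).enorm (hTm.sub_const _).enorm
    (δ := ENNReal.ofReal (ε * a * t ^ s)) (fun D => by
      have hdiff : ENNReal.ofReal (ε * a * t ^ s) = ‖(T D y - p₀ y) - (T D y - p₁ y)‖ₑ := by
        rw [← ofReal_norm, ← Real.norm_of_nonneg (r := ε * a * t ^ s) (by positivity)]
        congr 2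
        simp only [hp₀, hp₁, hg₁, Pi.add_apply, Pi.smul_apply, smul_eq_mul, huy]
        ring
      rw [hdiff]
      exact enorm_sub_le)
  have hsum : ENNReal.ofReal (ε * a * t ^ s) / 4 ≤ 2 * Φ := by
    rw [two_mul]
    refine htwo.trans (add_le_add ?_ ?_)
    · exact (lintegral_enorm_sub_le_risk (P := P₀) hT hB₀.1 hyint).trans hΦ₀
    · rw [hQf]
      exact (lintegral_enorm_sub_le_risk (P := P₁) hT hB₁.1 hyint).trans hΦ₁
  have hrate : ENNReal.ofReal (ε * a * t₀ ^ s / 8 * (n : ℝ) ^ (-(s / (2 * (s + 1))))) * 2 =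
      ENNReal.ofReal (ε * a * t ^ s) / 4 := by
    have h2 : (2 : ℝ≥0∞) = ENNReal.ofReal 2 := by norm_num
    have h4 : (4 : ℝ≥0∞) = ENNReal.ofReal 4 := by norm_num
    rw [h2, h4, ← ENNReal.ofReal_div_of_pos (by norm_num), ← ENNReal.ofReal_mul (by positivity),
      hts]
    congr 1
    ring
  rw [← hrate, mul_comm] at hsum
  exact (ENNReal.mul_le_mul_iff_right (by norm_num) (by norm_num)).1 hsum

/-- The law of a one-point diagram with a smooth bump density is a witness. -/
theorem leastDensityNorm_lt_top {L M q s : ℝ} {r : ℕ} (hL : 0 < L) (hM : 0 < M) (hq : 0 < q)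
    (hs : 0 < s) (hr : s < r) : leastDensityNorm L M q s r < ∞ := by
  obtain ⟨y, ρ, S, hρ, hball, hS, hSx⟩ := exists_single (L := L) (M := M) (q := q) hL hM hq
  obtain ⟨g, a, hgs, hgc, hg0, hg1, hgK, ha, hga⟩ := exists_base_density y hρ
  obtain ⟨C, hC⟩ := exists_isBesovBounded hs hr hgs hgc
  have hgI : Integrable g := hgs.continuous.integrable_of_hasCompactSupport hgc
  have hlg : ∫⁻ x, ENNReal.ofReal (g x) = 1 := by
    rw [← ofReal_integral_eq_lintegral_ofReal hgI (ae_of_all _ hg0), hg1, ENNReal.ofReal_one]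
  refine lt_of_le_of_lt ?_ ((hC.besovNorm_le L).trans_lt ENNReal.ofReal_lt_top)
  refine iInf₂_le_of_le ⟨singleLaw S g, isProbabilityMeasure_singleLaw hS hlg⟩ g
    (iInf_le_of_le ⟨?_, hgs.continuous.continuousOn⟩ le_rfl)
  exact isPersistenceDensity_of_eq_singleLaw hS hSx hgs.continuous.measurable hg0 hgK rfl

theorem exists_density_of_leastDensityNorm_lt {L M q s : ℝ} {r : ℕ} {b : ℝ≥0∞}
    (hb : leastDensityNorm L M q s r < b) :
    ∃ (P : ProbabilityMeasure (PersSpace L M q)) (p : Plane → ℝ),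
      IsPersistenceDensity P p ∧ ContinuousOn p (Omega L) ∧ besovNorm L s r p < b := by
  simp only [leastDensityNorm, iInf_lt_iff] at hb
  obtain ⟨P, p, ⟨hP, hp⟩, hlt⟩ := hb
  exact ⟨P, p, hP, hp, hlt⟩

theorem minimaxRisk_mono {L M q s B : ℝ} {r n : ℕ} {G G' : Set (Plane → ℝ)} (h : G ⊆ G') :
    minimaxRisk L M q s r B n G ≤ minimaxRisk L M q s r B n G' :=
  iInf₂_mono fun _ _ => iSup₂_mono fun _ _ => iSup_mono' fun hp => ⟨⟨hp.1, h hp.2⟩, le_rfl⟩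

end Persistence

theorem theorem3 (L M q s B : ℝ) (r : ℕ)
    (hL : 0 < L) (hM : 0 < M) (hq : 0 < q) (hs : 0 < s) (hB : 0 < B) (hr : s < r) :
    Persistence.leastDensityNorm L M q s r < ∞ ∧
    ∃ c : ℝ, 0 < c ∧ ∀ n : ℕ, 1 ≤ n →
      ENNReal.ofReal (c * (n : ℝ) ^ (-(s / (2 * (s + 1))))) ≤
          Persistence.minimaxRisk L M q s r B n Set.univ ∧
      (Persistence.leastDensityNorm L M q s r < ENNReal.ofReal B →
        ENNReal.ofReal (c * (n : ℝ) ^ (-(s / (2 * (s + 1))))) ≤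
          Persistence.minimaxRisk L M q s r B n (Persistence.besovBall L s r B)) := by
  have htop := Persistence.leastDensityNorm_lt_top (M := M) (q := q) hL hM hq hs hr
  refine ⟨htop, ?_⟩
  by_cases hlt : Persistence.leastDensityNorm L M q s r < ENNReal.ofReal B
  · obtain ⟨P, p, hP, hpc, hpB⟩ := Persistence.exists_density_of_leastDensityNorm_lt hlt
    obtain ⟨c, hc, hbound⟩ := Persistence.exists_le_iSup_risk hL hM hq hs hr hP hpc hpB
    refine ⟨c, hc, fun n hn => ?_⟩
    have key : ENNReal.ofReal (c * (n : ℝ) ^ (-(s / (2 * (s + 1))))) ≤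
        Persistence.minimaxRisk L M q s r B n (Persistence.besovBall L s r B) :=
      le_iInf₂ fun T hT => hbound n hn B T hT
    exact ⟨key.trans (Persistence.minimaxRisk_mono (Set.subset_univ _)), fun _ => key⟩
  · -- Densities of a larger Besov ball cannot be estimated any better.
    obtain ⟨P, p, hP, hpc, hpB⟩ := Persistence.exists_density_of_leastDensityNorm_lt htop
    have hpB' : Persistence.besovNorm L s r p <
        ENNReal.ofReal ((Persistence.besovNorm L s r p).toReal + 1) := by
      rw [ENNReal.lt_ofReal_iff_toReal_lt hpB.ne]
      linarith
    obtain ⟨c, hc, hbound⟩ := Persistence.exists_le_iSup_risk hL hM hq hs hr hP hpc hpB'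
    refine ⟨c, hc, fun n hn => ⟨?_, fun h => absurd h hlt⟩⟩
    refine le_iInf₂ fun T hT => (hbound n hn B T hT).trans ?_
    exact iSup₂_mono fun _ _ => iSup_mono' fun hp => ⟨⟨hp.1, trivial⟩, le_rfl⟩
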